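/- Let $G$ be a profinite group, and let $\mathcal S(G)$ be the set of closed subgroups of $G$ with the topology of the projective limit of the finite discrete spaces $\mathcal S(G/N)$, $N$ ranging over the open normal subgroups of $G$ (that is, the coarsest topology for which all the maps $H\mapsto HN/N$ into the discrete finite sets $\mathcal S(G/N)$ are continuous). Suppose that $\mathcal S(G)$ is countably infinite. Then the set of primes $p$ such that $p^\infty$ divides the order of $G$ (that is, such that for every $m\ge 0$ there is an open normal subgroup $N$ of $G$ with $p^m\mid |G:N|$) is finite; and, if $k$ denotes the number of these primes, there is a positive integer $n$ such that $\mathcal S(G)$ is homeomorphic to the ordinal $\omega^k\cdot n+1$ with its order topology. -/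

import Mathlib

/-- The topology on the space `S(G)` of closed subgroups of a profinite group `G`: it is the
topology of the projective limit of the finite discrete spaces of subgroups of `G ⧸ N`, where `N`
runs over the open normal subgroups of `G`. In other words, it is the coarsest topology that makes
each map `H ↦ HN/N` into the discrete set of subgroups of `G ⧸ N` continuous. -/
instance ClosedSubgroup.instTopologicalSpace {G : Type*} [Group G] [TopologicalSpace G] :
    TopologicalSpace (ClosedSubgroup G) :=
  ⨅ N : OpenNormalSubgroup G,
    TopologicalSpace.induced
      (fun H : ClosedSubgroup G => H.toSubgroup.map (QuotientGroup.mk' N.toSubgroup))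
      (⊥ : TopologicalSpace (Subgroup (G ⧸ N.toSubgroup)))

/-- The order `o(G)` of a profinite group, as a supernatural number (Steinitz number)
`∏ p ^ e p` with `e p ∈ {0, 1, 2, …, ∞}`, given by its exponent function `e`. It is the least
common multiple of the indices `|G : N|` of the open normal subgroups `N` of `G`. -/
noncomputable def profiniteOrder (G : Type*) [Group G] [TopologicalSpace G] (p : Nat.Primes) :
    ℕ∞ :=
  ⨆ N : OpenNormalSubgroup G, emultiplicity (p : ℕ) N.toSubgroup.index

/-- The set of primes `p` such that `p ^ ∞` divides the order of the profinite group `G`. -/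
def infinitePrimes (G : Type*) [Group G] [TopologicalSpace G] : Set Nat.Primes :=
  {p | profiniteOrder G p = ⊤}

/-!
The proof has a group-theoretic and a topological half, joined by a rank function on `S(G)`.

*Structure of `G`.* If `G` has countably many closed subgroups, then it is the union of countably
many closed procyclic subgroups, so by Baire's theorem each nonempty open set meets an open
procyclic subgroup (`exists_isOpen_procyclic_inter`). Applied to the cosets of one open procyclic
subgroup, this shows that each element commutes with an open subgroup, hence that the center is
open (`isOpen_center`), and some central `g` generates an open subgroup topologically. Only
finitely many primes divide the order of that subgroup
(`finite_setOf_procyclic_pow_ne`), and a minimal choice of `g` makes it isomorphic to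
`A = ∏ p ∈ π, ℤ_p` for a finite set `π` of primes (`exists_isCentralGenerator`). Since `A` has
finite index, `π` is the set of the primes `p` with `p ^ ∞` dividing the order of `G`. The
`p`-adic integers are not used explicitly: a closed subgroup `B` of `A` is described by the set of
the prime powers `p ^ j` with `B ≤ A ^ (p ^ j)` (`IsCentralGenerator.mem_of_forall_le`).

*Rank.* The rank of a closed subgroup `H` is the number of `p ∈ π` for which `H ∩ A` has trivial
`p`-component. If `K` is close to `H`, then `K ∩ A` and `H ∩ A` agree in the nontrivial components
of `H ∩ A`; so `K` has at most the rank of `H`, with equality only if `K ∩ A = H ∩ A`, and in that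
case `K = H` because `A` is central and torsion-free
(`IsCentralGenerator.eventually_trivialPrimes_ssubset`). Conversely, multiplying `H` by a small
subgroup `p ^ m ℤ_p` lowers the rank by one
(`IsCentralGenerator.frequently_trivialPrimes_eq_erase`). Hence this is the Cantor–Bendixson rank,
and its maximum `k = |π|` is attained at the trivial subgroup.

*Topology.* `S(G)` is a countable compact space, and such a space of rank `k` with `n` points of
maximal rank is homeomorphic to `ω ^ k * n + 1`
(`IsCantorBendixsonRank.nonempty_homeomorph`): a point of rank `k + 1` has a clopen neighbourhood
that is the one-point compactification of a sequence of clopen sets with one point of rank `k`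
each, just as `Ioc a (a + ω ^ (k + 1))` is that of the intervals
`Ioc (a + ω ^ k * i) (a + ω ^ k * (i + 1))`.
-/

open Set Filter Topology

/-! ### Spaces of finite Cantor–Bendixson rank -/

/-- `r` is the Cantor–Bendixson rank of a space in which every point has finite rank: near a point
`x` all other points have rank less than `r x`, and if `r x = j + 1` then points of rank `j`
accumulate at `x`. Thus `r x = 0` means that `x` is isolated, and so on. -/
structure IsCantorBendixsonRank {X : Type*} [TopologicalSpace X] (r : X → ℕ) : Prop where
  eventually_lt : ∀ x, ∀ᶠ y in 𝓝 x, y ≠ x → r y < r x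
  frequently_eq : ∀ x j, r x = j + 1 → ∃ᶠ y in 𝓝 x, r y = j

namespace IsCantorBendixsonRank

variable {X : Type*} [TopologicalSpace X] {r : X → ℕ}

theorem exists_isClopen [T2Space X] [CompactSpace X] [TotallyDisconnectedSpace X]
    (hr : IsCantorBendixsonRank r) {O : Set X} (hO : IsOpen O) {x : X} (hx : x ∈ O) :
    ∃ W, IsClopen W ∧ x ∈ W ∧ W ⊆ O ∧ ∀ w ∈ W, w ≠ x → r w < r x := by
  obtain ⟨T, hT, hTo, hxT⟩ := eventually_nhds_iff.1 (hr.eventually_lt x)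
  obtain ⟨W, hW, hxW, hWO⟩ := compact_exists_isClopen_in_isOpen (hO.inter hTo) ⟨hx, hxT⟩
  exact ⟨W, hW, hxW, fun w hw => (hWO hw).1, fun w hw => hT w (hWO hw).2⟩

theorem infinite_of_mem_nhds [T1Space X] (hr : IsCantorBendixsonRank r) {x : X} {j : ℕ}
    (hx : r x = j + 1) {U : Set X} (hU : U ∈ 𝓝 x) : {y ∈ U | r y = j}.Infinite := by
  intro hfin
  have h1 : {y ∈ U | r y = j}ᶜ ∈ 𝓝 x :=
    hfin.isClosed.isOpen_compl.mem_nhds (by simp [hx])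
  obtain ⟨y, hy, hyU, hyc⟩ := ((hr.frequently_eq x j hx).and_eventually
    ((eventually_mem_set.2 hU).and (eventually_mem_set.2 h1))).exists
  exact hyc ⟨hyU, hy⟩

theorem finite_setOf_eq [CompactSpace X] (hr : IsCantorBendixsonRank r) {k : ℕ}
    (hk : ∀ x, r x ≤ k) : {x | r x = k}.Finite := by
  choose! T hT hTo hxT using fun x => eventually_nhds_iff.1 (hr.eventually_lt x)
  obtain ⟨t, ht⟩ := isCompact_univ.elim_finite_subcover T hTo
    (fun x _ => mem_iUnion.2 ⟨x, hxT x⟩)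
  refine t.finite_toSet.subset fun x hx => ?_
  obtain ⟨y, hy, hxy⟩ := mem_iUnion₂.1 (ht (mem_univ x))
  by_contra hxt
  have := hT y x hxy (fun h => hxt (h ▸ hy))
  have h2 := hk y
  rw [mem_ofPred_eq] at hx
  omega

theorem exists_eq_zero [Nonempty X] (hr : IsCantorBendixsonRank r) : ∃ x, r x = 0 := by
  obtain ⟨x, hx⟩ : ∃ x, ∀ y, r x ≤ r y :=
    ⟨Function.argmin r, fun y => Function.argmin_le r y⟩
  refine ⟨x, ?_⟩
  by_contra h
  obtain ⟨j, hj⟩ := Nat.exists_eq_succ_of_ne_zero h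
  obtain ⟨y, hy⟩ := (hr.frequently_eq x j hj).exists
  have := hx y
  omega

theorem isOpen_singleton [T1Space X] (hr : IsCantorBendixsonRank r) {x : X} (hx : r x = 0) :
    IsOpen {x} := by
  rw [isOpen_singleton_iff_nhds_eq_pure]
  refine le_antisymm ?_ (pure_le_nhds x)
  rw [le_pure_iff]
  filter_upwards [hr.eventually_lt x] with y hy
  by_contra h
  have := hy h
  omega

/-- A punctured neighbourhood of a point of rank `k + 1` is a disjoint union of a sequence of
clopen sets, each of which has exactly one point of rank `k` and otherwise points of smaller
rank. -/
theorem exists_partition [T2Space X] [CompactSpace X] [TotallyDisconnectedSpace X] [Countable X]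
    (hr : IsCantorBendixsonRank r) {U : Set X} (hU : IsClopen U) {x : X} {k : ℕ} (hx : x ∈ U)
    (hxk : r x = k + 1) (hlt : ∀ y ∈ U, y ≠ x → r y < k + 1) :
    ∃ V : ℕ → Set X, (∀ i, IsClopen (V i)) ∧ Pairwise (Function.onFun Disjoint V) ∧
      ⋃ i, V i = U \ {x} ∧
      ∀ i, ∃ y ∈ V i, r y = k ∧ ∀ z ∈ V i, z ≠ y → r z < k := by
  have hO : IsOpen (U \ {x}) := hU.isOpen.sdiff isClosed_singleton
  have hinf := hr.infinite_of_mem_nhds hxk (hU.isOpen.mem_nhds hx)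
  have : Infinite {y ∈ U | r y = k} := hinf.to_subtype
  obtain ⟨e⟩ : Nonempty (ℕ ≃ {y ∈ U | r y = k}) := nonempty_equiv_of_countable
  have hemem : ∀ i, (e i : X) ∈ U \ {x} := fun i => ⟨(e i).2.1, fun h => by
    have h2 := (e i).2.2
    rw [mem_singleton_iff.1 h] at h2
    omega⟩
  have : Nonempty (U \ {x} : Set X) := ⟨⟨e 0, hemem 0⟩⟩
  obtain ⟨z, hz⟩ := exists_surjective_nat (U \ {x} : Set X)
  choose W hWc hW hWU hWr using fun i => hr.exists_isClopen hO (hemem i)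
  have hZ : ∀ i, ∃ Z : Set X, IsClopen Z ∧ Z ⊆ U \ {x} ∧ (r (z i) < k → (z i : X) ∈ Z) ∧
      ∀ w ∈ Z, r w < k := by
    intro i
    by_cases hi : r (z i) < k
    · obtain ⟨Z, h1, h2, h3, h4⟩ := hr.exists_isClopen hO (z i).2
      refine ⟨Z, h1, h3, fun _ => h2, fun w hw => ?_⟩
      by_cases h : w = z i
      · rwa [h]
      · exact (h4 w hw h).trans hi
    · exact ⟨∅, isClopen_empty, empty_subset _, fun h => absurd h hi, by simp⟩
  choose Z hZc hZU hzZ hZr using hZ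
  have hWk : ∀ i, ∀ w ∈ W i, w ≠ e i → r w < k := fun i w hw hne => by
    have := hWr i w hw hne
    rwa [(e i).2.2] at this
  have hcl : ∀ i, IsClopen (W i ∪ Z i) := fun i => (hWc i).union (hZc i)
  refine ⟨disjointed fun i => W i ∪ Z i, fun i => ?_, disjoint_disjointed _, ?_, fun i => ?_⟩
  · refine disjointedRec (p := fun s => IsClopen s) (fun s j hs => hs.diff (hcl j)) (hcl i)
  · rw [iUnion_disjointed]
    apply subset_antisymm
    · exact iUnion_subset fun i => union_subset (hWU i) (hZU i)
    · intro y hy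
      by_cases hyk : r y < k
      · obtain ⟨i, hi⟩ := hz ⟨y, hy⟩
        refine mem_iUnion.2 ⟨i, Or.inr ?_⟩
        have := hzZ i
        rw [hi] at this
        exact this hyk
      · have h1 := hlt y hy.1 hy.2
        obtain ⟨i, hi⟩ := e.surjective ⟨y, hy.1, by omega⟩
        refine mem_iUnion.2 ⟨i, Or.inl ?_⟩
        have := hW i
        rwa [hi] at this
  · refine ⟨e i, ?_, (e i).2.2, fun w hw hne => ?_⟩
    · rw [disjointed_apply, Set.mem_sdiff]
      refine ⟨Or.inl (hW i), ?_⟩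
      simp only [Finset.sup_set_eq_biUnion, mem_iUnion, Finset.mem_Iio, not_exists]
      rintro j hj (h | h)
      · have h1 := hWk j _ h fun h => hj.ne' (e.injective (Subtype.ext h))
        exact h1.ne (e i).2.2
      · exact (hZr j _ h).ne (e i).2.2
    · rcases disjointed_subset _ i hw with h | h
      · exact hWk i w h hne
      · exact hZr i w h

end IsCantorBendixsonRank

section Glue

variable {X Y : Type*} [TopologicalSpace X] [TopologicalSpace Y]

/-- Gluing of bijections over a partition into a point and a sequence of clopen sets. The result is
continuous at the exceptional point because, by compactness, each neighbourhood of its image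
contains almost all members of the target partition. -/
theorem exists_bijOn_of_partition {U : Set X} {V : Set Y} {x : X} {y : Y}
    {P : ℕ → Set X} {Q : ℕ → Set Y} (hU : IsOpen U) (hx : x ∈ U) (hP : ∀ i, IsClopen (P i))
    (hPd : Pairwise (Function.onFun Disjoint P)) (hPU : ⋃ i, P i = U \ {x})
    (hV : IsCompact V) (hy : y ∈ V) (hQ : ∀ i, IsOpen (Q i))
    (hQd : Pairwise (Function.onFun Disjoint Q)) (hQV : ⋃ i, Q i = V \ {y})
    (h : ∀ i, ∃ f : X → Y, ContinuousOn f (P i) ∧ BijOn f (P i) (Q i)) :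
    ∃ f : X → Y, ContinuousOn f U ∧ BijOn f U V := by
  classical
  choose f hfc hfb using h
  let F : X → Y := fun z => if h : ∃ i, z ∈ P i then f h.choose z else y
  have hF : ∀ i, EqOn F (f i) (P i) := by
    intro i z hz
    have h : ∃ i, z ∈ P i := ⟨i, hz⟩
    have : h.choose = i := by
      by_contra hne
      exact (hPd hne).le_bot ⟨h.choose_spec, hz⟩
    simp only [F, dif_pos h, this]
  have hxP : ∀ i, x ∉ P i := fun i hi => by
    have : x ∈ U \ {x} := hPU ▸ mem_iUnion.2 ⟨i, hi⟩
    exact this.2 rfl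
  have hFx : F x = y := by
    have h : ¬ ∃ i, x ∈ P i := fun ⟨i, hi⟩ => hxP i hi
    simp only [F, dif_neg h]
  have hcases : ∀ z ∈ U, z = x ∨ ∃ i, z ∈ P i := fun z hz => by
    by_cases hzx : z = x
    · exact Or.inl hzx
    · have : z ∈ ⋃ i, P i := hPU ▸ ⟨hz, hzx⟩
      exact Or.inr (mem_iUnion.1 this)
  have hmem : ∀ i, ∀ z ∈ P i, F z ∈ Q i := fun i z hz => by
    rw [hF i hz]
    exact (hfb i).mapsTo hz
  have hQs : ∀ i, Q i ⊆ V \ {y} := fun i => hQV ▸ subset_iUnion Q i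
  have hmaps : MapsTo F U V := by
    intro z hz
    rcases hcases z hz with rfl | ⟨i, hi⟩
    · rwa [hFx]
    · exact (hQs i (hmem i z hi)).1
  refine ⟨F, ?_, hmaps, ?_, ?_⟩
  · intro z hz
    apply ContinuousAt.continuousWithinAt
    rcases hcases z hz with rfl | ⟨i, hi⟩
    · rw [ContinuousAt, hFx]
      intro O hO
      obtain ⟨O', hO', hO'o, hyO'⟩ := mem_nhds_iff.1 hO
      obtain ⟨t, ht⟩ := (hV.diff hO'o).elim_finite_subcover Q hQ (by
        rw [hQV]
        exact sdiff_subset_sdiff_right (singleton_subset_iff.2 hyO'))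
      have hn : (U ∩ ⋂ i ∈ t, (P i)ᶜ) ∈ 𝓝 z := by
        refine inter_mem (hU.mem_nhds hx) ((biInter_finset_mem t).2 fun i _ => ?_)
        exact (hP i).compl.isOpen.mem_nhds (hxP i)
      refine mem_map.2 ?_
      filter_upwards [hn] with w hw
      by_contra hwO
      obtain ⟨i, hit, hi⟩ := mem_iUnion₂.1 (ht ⟨hmaps hw.1, fun h => hwO (hO' h)⟩)
      rcases hcases w hw.1 with rfl | ⟨j, hj⟩
      · exact hwO (hO' (hFx ▸ hyO'))
      · by_cases hij : i = j
        · subst hij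
          exact mem_iInter₂.1 hw.2 i hit hj
        · exact (hQd hij).le_bot ⟨hi, hmem j w hj⟩
    · have hn := (hP i).isOpen.mem_nhds hi
      exact ((hfc i).continuousAt hn).congr ((hF i).eventuallyEq_of_mem hn).symm
  · intro a ha b hb hab
    rcases hcases a ha with rfl | ⟨i, hi⟩ <;> rcases hcases b hb with rfl | ⟨j, hj⟩
    · rfl
    · exact absurd (hab.symm.trans hFx) (hQs j (hmem j b hj)).2
    · exact absurd (hab.trans hFx) (hQs i (hmem i a hi)).2
    · have hij : i = j := by
        by_contra hij
        exact (hQd hij).le_bot ⟨hmem i a hi, hab ▸ hmem j b hj⟩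
      subst hij
      rw [hF i hi, hF i hj] at hab
      exact (hfb i).injOn hi hj hab
  · intro b hb
    by_cases hby : b = y
    · exact ⟨x, hx, hFx.trans hby.symm⟩
    · have : b ∈ ⋃ i, Q i := hQV ▸ ⟨hb, hby⟩
      obtain ⟨i, hi⟩ := mem_iUnion.1 this
      obtain ⟨a, ha, rfl⟩ := (hfb i).surjOn hi
      have haU : a ∈ U \ {x} := hPU ▸ mem_iUnion.2 ⟨i, ha⟩
      exact ⟨a, haU.1, hF i ha⟩

theorem exists_bijOn_union {U₁ U₂ : Set X} {V₁ V₂ : Set Y} (hU₁ : IsOpen U₁) (hU₂ : IsOpen U₂)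
    (hU : Disjoint U₁ U₂) (hV : Disjoint V₁ V₂)
    (h₁ : ∃ f : X → Y, ContinuousOn f U₁ ∧ BijOn f U₁ V₁)
    (h₂ : ∃ f : X → Y, ContinuousOn f U₂ ∧ BijOn f U₂ V₂) :
    ∃ f : X → Y, ContinuousOn f (U₁ ∪ U₂) ∧ BijOn f (U₁ ∪ U₂) (V₁ ∪ V₂) := by
  classical
  obtain ⟨f, hfc, hfb⟩ := h₁
  obtain ⟨g, hgc, hgb⟩ := h₂
  have e₁ : EqOn (U₁.piecewise f g) f U₁ := piecewise_eqOn _ _ _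
  have e₂ : EqOn (U₁.piecewise f g) g U₂ := fun z hz =>
    piecewise_eq_of_notMem _ _ _ fun h => hU.le_bot ⟨h, hz⟩
  have b₁ := hfb.congr e₁.symm
  have b₂ := hgb.congr e₂.symm
  refine ⟨U₁.piecewise f g, (hfc.congr e₁).union_of_isOpen (hgc.congr e₂) hU₁ hU₂,
    b₁.union b₂ ?_⟩
  rw [injOn_union hU]
  exact ⟨b₁.injOn, b₂.injOn, fun a ha b hb hab => hV.le_bot ⟨b₁.mapsTo ha, hab ▸ b₂.mapsTo hb⟩⟩

end Glue

/-! ### Ordinal intervals as models -/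

theorem Ordinal.isClopen_Ioc (a b : Ordinal.{0}) : IsClopen (Ioc a b) := by
  constructor
  · have : Ioc a b = Icc (Order.succ a) b := by ext; simp
    rw [this]
    exact isClosed_Icc
  · have : Ioc a b = Ioo a (Order.succ b) := by ext; simp
    rw [this]
    exact isOpen_Ioo

theorem Ordinal.isCompact_Ioc (a b : Ordinal.{0}) : IsCompact (Ioc a b) :=
  isCompact_Icc.of_isClosed_subset (Ordinal.isClopen_Ioc a b).isClosed Ioc_subset_Icc_self

namespace IsCantorBendixsonRank

open Ordinal

variable {X : Type*} [TopologicalSpace X] {r : X → ℕ} [T2Space X] [CompactSpace X]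
  [TotallyDisconnectedSpace X] [Countable X]

/-- The classification of clopen sets with a single point of maximal rank `k`. -/
theorem exists_bijOn_Ioc (hr : IsCantorBendixsonRank r) {k : ℕ} {U : Set X} (hU : IsClopen U)
    {x : X} (hx : x ∈ U) (hxk : r x = k) (hlt : ∀ y ∈ U, y ≠ x → r y < k) (a : Ordinal.{0}) :
    ∃ f : X → Ordinal.{0}, ContinuousOn f U ∧ BijOn f U (Ioc a (a + ω ^ k)) := by
  induction k generalizing U x a with
  | zero =>
    have hUx : U = {x} := eq_singleton_iff_unique_mem.2
      ⟨hx, fun y hy => by_contra fun h => absurd (hlt y hy h) (by simp)⟩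
    have hI : Ioc a (a + ω ^ 0) = {a + 1} := by
      ext b
      simp only [pow_zero, mem_Ioc, mem_singleton_iff]
      rw [← Order.succ_eq_add_one, ← Order.succ_le_iff]
      exact ⟨fun h => le_antisymm h.2 h.1, fun h => ⟨h.ge, h.le⟩⟩
    rw [hUx, hI]
    exact ⟨fun _ => a + 1, continuousOn_const, bijOn_singleton.2 rfl⟩
  | succ k ih =>
    obtain ⟨P, hP, hPd, hPU, hPy⟩ := hr.exists_partition hU hx hxk hlt
    have hmono : StrictMono fun i : ℕ => a + ω ^ k * (i : Ordinal.{0}) := fun i j hij => by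
      have : (0 : Ordinal.{0}) < ω ^ k := pow_pos omega0_pos k
      beta_reduce
      gcongr
    refine exists_bijOn_of_partition (y := a + ω ^ (k + 1))
      (Q := fun i : ℕ =>
        Ioc (a + ω ^ k * (i : Ordinal.{0})) (a + ω ^ k * ((i + 1 : ℕ) : Ordinal.{0})))
      hU.isOpen hx hP hPd hPU (Ordinal.isCompact_Ioc _ _) ?_
      (fun i => (Ordinal.isClopen_Ioc _ _).isOpen) ?_ ?_ (fun i => ?_)
    · exact ⟨lt_add_of_pos_right _ (pow_pos omega0_pos _), le_rfl⟩
    · exact hmono.monotone.pairwise_disjoint_on_Ioc_succ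
    · ext b
      simp only [mem_iUnion, Set.mem_sdiff, mem_Ioc, mem_singleton_iff]
      have hlim : ∀ i : ℕ, a + ω ^ k * (i : Ordinal.{0}) < a + ω ^ (k + 1) := fun i => by
        rw [pow_succ]
        have : (0 : Ordinal.{0}) < ω ^ k := pow_pos omega0_pos k
        have h2 := natCast_lt_omega0 i
        gcongr
      constructor
      · rintro ⟨i, hi, hi'⟩
        refine ⟨⟨(le_add_of_nonneg_right zero_le).trans_lt hi,
          hi'.trans (hlim (i + 1)).le⟩, (hi'.trans_lt (hlim (i + 1))).ne⟩
      · rintro ⟨⟨h1, h2⟩, h3⟩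
        have h4 := lt_of_le_of_ne h2 h3
        obtain ⟨c, rfl⟩ := exists_add_of_le h1.le
        rw [add_lt_add_iff_left, pow_succ, lt_mul_iff_of_isSuccLimit isSuccLimit_omega0] at h4
        obtain ⟨c', hc', hc⟩ := h4
        obtain ⟨m, rfl⟩ := lt_omega0.1 hc'
        have hex : ∃ m : ℕ, c ≤ ω ^ k * (m : Ordinal.{0}) := ⟨m, hc.le⟩
        classical
        have hspec := Nat.find_spec hex
        have hmin := fun j => Nat.find_min hex (m := j)
        rcases hn : Nat.find hex with _ | n
        · rw [hn] at hspec
          have : c = 0 := by simpa using hspec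
          simp [this] at h1
        · rw [hn] at hspec
          refine ⟨n, ?_, ?_⟩
          · have := hmin n (by omega)
            rw [not_le] at this
            gcongr
          · gcongr
    · obtain ⟨y, hy, hyk, hylt⟩ := hPy i
      have := ih (hP i) hy hyk hylt (a + ω ^ k * (i : Ordinal.{0}))
      rwa [add_assoc, ← mul_add_one, ← Nat.cast_succ] at this

/-- The classification of clopen sets with `n + 1` points of maximal rank `k`. -/
theorem exists_bijOn_Ioc_mul (hr : IsCantorBendixsonRank r) {k n : ℕ} {U : Set X}
    (hU : IsClopen U) (hle : ∀ y ∈ U, r y ≤ k) (hn : {y ∈ U | r y = k}.ncard = n + 1)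
    (a : Ordinal.{0}) : ∃ f : X → Ordinal.{0}, ContinuousOn f U ∧
      BijOn f U (Ioc a (a + ω ^ k * ((n + 1 : ℕ) : Ordinal.{0}))) := by
  induction n generalizing U with
  | zero =>
    obtain ⟨x, hx⟩ := ncard_eq_one.1 hn
    have hxU : x ∈ U ∧ r x = k := (Set.ext_iff.1 hx x).2 rfl
    have := hr.exists_bijOn_Ioc hU hxU.1 hxU.2 (fun y hy hne =>
      lt_of_le_of_ne (hle y hy) fun h => hne ((Set.ext_iff.1 hx y).1 ⟨hy, h⟩)) a
    simpa using this
  | succ n ih =>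
    have hne : {y ∈ U | r y = k}.Nonempty := nonempty_of_ncard_ne_zero (by omega)
    obtain ⟨x, hxU, hxk⟩ := hne
    obtain ⟨W, hW, hxW, hWU, hWr⟩ := hr.exists_isClopen hU.isOpen hxU
    have hset : {y ∈ U \ W | r y = k} = {y ∈ U | r y = k} \ {x} := by
      ext y
      simp only [Set.mem_sdiff, mem_ofPred_eq, mem_singleton_iff]
      constructor
      · rintro ⟨⟨h1, h2⟩, h3⟩
        exact ⟨⟨h1, h3⟩, fun h => h2 (h ▸ hxW)⟩
      · rintro ⟨⟨h1, h2⟩, h3⟩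
        exact ⟨⟨h1, fun h => ((hWr y h h3).trans_eq hxk).ne h2⟩, h2⟩
    have h1 := ih (hU.diff hW) (fun y hy => hle y hy.1) (by
      rw [hset, ncard_sdiff_singleton_of_mem (by exact ⟨hxU, hxk⟩)]
      omega)
    have h2 := hr.exists_bijOn_Ioc hW hxW hxk (fun y hy hne => (hWr y hy hne).trans_eq hxk)
      (a + ω ^ k * ((n + 1 : ℕ) : Ordinal.{0}))
    have := exists_bijOn_union (hU.diff hW).isOpen hW.isOpen disjoint_sdiff_left
      (Ioc_disjoint_Ioc_of_le le_rfl) h1 h2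
    rw [sdiff_union_of_subset hWU, Ioc_union_Ioc_eq_Ioc
      (le_add_of_nonneg_right zero_le) (le_add_of_nonneg_right zero_le),
      add_assoc, ← mul_add_one, ← Nat.cast_succ] at this
    exact this

/-- The theorem of Mazurkiewicz and Sierpiński for finite rank: a countable compact space of
finite Cantor–Bendixson rank `k > 0` is homeomorphic to `ω ^ k * n + 1`, where `n` is the number
of points of rank `k`. -/
theorem nonempty_homeomorph (hr : IsCantorBendixsonRank r) {k : ℕ} (hk : k ≠ 0)
    (hle : ∀ y, r y ≤ k) (hmax : ∃ y, r y = k) :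
    ∃ n : ℕ, 0 < n ∧ Nonempty (X ≃ₜ Iio (ω ^ k * (n : Ordinal.{0}) + 1)) := by
  have hfin := hr.finite_setOf_eq hle
  obtain ⟨y, hy⟩ := hmax
  have : Nonempty X := ⟨y⟩
  obtain ⟨x, hx⟩ := hr.exists_eq_zero
  have hxo := hr.isOpen_singleton hx
  obtain ⟨n, hn⟩ : ∃ n, {y | r y = k}.ncard = n + 1 := Nat.exists_eq_succ_of_ne_zero
    ((ncard_pos hfin).2 ⟨y, hy⟩).ne'
  refine ⟨n + 1, n.succ_pos, ?_⟩
  have hcl : IsClopen ({x} : Set X) := ⟨isClosed_singleton, hxo⟩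
  have hset : {y ∈ ({x}ᶜ : Set X) | r y = k} = {y | r y = k} := by
    ext z
    simp only [mem_compl_iff, mem_singleton_iff, mem_ofPred_eq, and_iff_right_iff_imp]
    rintro h rfl
    exact hk (h.symm.trans hx)
  have h1 := hr.exists_bijOn_Ioc_mul hcl.compl (fun y _ => hle y) (hset ▸ hn) 0
  -- The interval `Ioc 0 _` misses the ordinal `0`, which is matched with an isolated point.
  have h2 := exists_bijOn_union (V₁ := {(0 : Ordinal.{0})}) hxo hcl.compl.isOpen
    disjoint_compl_right (by simp) ⟨fun _ => 0, continuousOn_const, bijOn_singleton.2 rfl⟩ h1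
  obtain ⟨f, hfc, hfb⟩ := h2
  rw [union_compl_self, zero_add, singleton_union, Ioc_insert_left zero_le] at hfb
  rw [union_compl_self, continuousOn_univ] at hfc
  have hI : Icc 0 (ω ^ k * ((n + 1 : ℕ) : Ordinal.{0})) =
      Iio (ω ^ k * ((n + 1 : ℕ) : Ordinal.{0}) + 1) := by
    ext b
    simp [Order.lt_add_one_iff]
  rw [hI] at hfb
  let F : X → Iio (ω ^ k * ((n + 1 : ℕ) : Ordinal.{0}) + 1) :=
    fun z => ⟨f z, hfb.mapsTo (mem_univ z)⟩
  have hF : Function.Bijective F := by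
    constructor
    · intro a b hab
      exact hfb.injOn (mem_univ a) (mem_univ b) (congrArg Subtype.val hab)
    · rintro ⟨b, hb⟩
      obtain ⟨a, -, ha⟩ := hfb.surjOn hb
      exact ⟨a, Subtype.ext ha⟩
  exact ⟨Continuous.homeoOfEquivCompactToT2 (f := Equiv.ofBijective F hF)
    (hfc.subtype_mk _)⟩

end IsCantorBendixsonRank

/-! ### The space of closed subgroups -/

namespace ClosedSubgroup

variable {G : Type*} [Group G] [TopologicalSpace G]

theorem map_mk'_eq_iff (N : OpenNormalSubgroup G) (H K : Subgroup G) :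
    H.map (QuotientGroup.mk' N.toSubgroup) = K.map (QuotientGroup.mk' N.toSubgroup) ↔
      H ⊔ N.toSubgroup = K ⊔ N.toSubgroup := by
  rw [Subgroup.map_eq_map_iff, QuotientGroup.ker_mk']

theorem nhds_eq_iInf (H : ClosedSubgroup G) :
    𝓝 H = ⨅ N : OpenNormalSubgroup G,
      𝓟 {K : ClosedSubgroup G |
        K.toSubgroup ⊔ N.toSubgroup = H.toSubgroup ⊔ N.toSubgroup} := by
  refine (nhds_iInf (a := H)).trans (iInf_congr fun N => ?_)
  let : TopologicalSpace (Subgroup (G ⧸ N.toSubgroup)) := ⊥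
  have : DiscreteTopology (Subgroup (G ⧸ N.toSubgroup)) := ⟨rfl⟩
  rw [nhds_induced, nhds_discrete, comap_pure]
  congr 1
  ext K
  exact map_mk'_eq_iff N _ _

/-- Two closed subgroups are close if they have the same product with a small open normal
subgroup. -/
theorem hasBasis_nhds (H : ClosedSubgroup G) :
    (𝓝 H).HasBasis (fun _ : OpenNormalSubgroup G => True) fun N =>
      {K : ClosedSubgroup G |
        K.toSubgroup ⊔ N.toSubgroup = H.toSubgroup ⊔ N.toSubgroup} := by
  rw [nhds_eq_iInf]
  have : Nonempty (OpenNormalSubgroup G) := ⟨⟨⊤, inferInstanceAs (⊤ : Subgroup G).Normal⟩⟩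
  refine hasBasis_iInf_principal fun M N => ⟨M ⊓ N, ?_, ?_⟩
  · intro K hK
    have h : (M ⊓ N).toSubgroup ≤ M.toSubgroup := fun x hx => hx.1
    have := congrArg (· ⊔ M.toSubgroup) hK
    simpa [sup_assoc, sup_eq_right.2 h] using this
  · intro K hK
    have h : (M ⊓ N).toSubgroup ≤ N.toSubgroup := fun x hx => hx.2
    have := congrArg (· ⊔ N.toSubgroup) hK
    simpa [sup_assoc, sup_eq_right.2 h] using this

theorem isOpen_of_sup_eq (N : OpenNormalSubgroup G) {T : Set (ClosedSubgroup G)}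
    (hT : ∀ H ∈ T, ∀ K : ClosedSubgroup G,
      K.toSubgroup ⊔ N.toSubgroup = H.toSubgroup ⊔ N.toSubgroup → K ∈ T) : IsOpen T :=
  isOpen_iff_mem_nhds.2 fun H hH =>
    (hasBasis_nhds H).mem_iff.2 ⟨N, trivial, fun K hK => hT H hH K hK⟩

variable [IsTopologicalGroup G] [CompactSpace G] [TotallyDisconnectedSpace G]

theorem mem_of_forall_mem_sup {H : Subgroup G} (hH : IsClosed (H : Set G)) {x : G}
    (hx : ∀ N : OpenNormalSubgroup G, x ∈ H ⊔ N.toSubgroup) : x ∈ H := by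
  by_contra hxH
  have ho : IsOpen ((fun y => x * y) ⁻¹' (H : Set G)ᶜ) :=
    hH.isOpen_compl.preimage (continuous_const_mul x)
  obtain ⟨N, hN⟩ := ProfiniteGrp.exist_openNormalSubgroup_sub_open_nhds_of_one ho (by simpa)
  obtain ⟨h, hh, n, hn, rfl⟩ := Subgroup.mem_sup_of_normal_right.1 (hx N)
  have := hN (N.toSubgroup.inv_mem hn)
  simp [hh] at this

instance : TotallySeparatedSpace (ClosedSubgroup G) := by
  rw [totallySeparatedSpace_iff_exists_isClopen]
  intro H K hHK
  have : ∃ N : OpenNormalSubgroup G,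
      H.toSubgroup ⊔ N.toSubgroup ≠ K.toSubgroup ⊔ N.toSubgroup := by
    by_contra! h
    refine hHK (toSubgroup_injective (le_antisymm (fun x hx => ?_) fun x hx => ?_))
    · exact mem_of_forall_mem_sup K.isClosed' fun N => h N ▸ Subgroup.mem_sup_left hx
    · exact mem_of_forall_mem_sup H.isClosed' fun N => h N ▸ Subgroup.mem_sup_left hx
  obtain ⟨N, hN⟩ := this
  refine ⟨{L | L.toSubgroup ⊔ N.toSubgroup = H.toSubgroup ⊔ N.toSubgroup}, ⟨⟨?_⟩, ?_⟩, rfl,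
    fun h => hN h.symm⟩
  · refine isOpen_of_sup_eq N fun L hL L' h h' => hL ?_
    exact h.symm.trans h'
  · exact isOpen_of_sup_eq N fun L hL L' h => h.trans hL

/-- An ultrafilter of closed subgroups `K` converges to the subgroup of all elements that lie in
almost all `KN`, for each open normal `N`; compactness of `G` shows that this limit has the right
image in each `G ⧸ N`. -/
instance : CompactSpace (ClosedSubgroup G) := by
  refine ⟨isCompact_iff_ultrafilter_le_nhds.2 fun F _ => ?_⟩
  have hQ : ∀ N : OpenNormalSubgroup G, ∃ L : Subgroup G,
      ∀ᶠ K : ClosedSubgroup G in F, K.toSubgroup ⊔ N.toSubgroup = L := by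
    intro N
    have : Finite (G ⧸ N.toSubgroup) := N.toSubgroup.quotient_finite_of_isOpen N.isOpen'
    obtain ⟨Q, hQ⟩ := Ultrafilter.eq_pure_of_finite (F.map fun K : ClosedSubgroup G =>
      K.toSubgroup.map (QuotientGroup.mk' N.toSubgroup))
    refine ⟨Q.comap (QuotientGroup.mk' N.toSubgroup), ?_⟩
    have h : ({Q} : Set _) ∈ F.map fun K : ClosedSubgroup G =>
        K.toSubgroup.map (QuotientGroup.mk' N.toSubgroup) := by
      rw [hQ]
      exact mem_pure.2 rfl
    filter_upwards [Ultrafilter.mem_map.1 h] with K hK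
    rw [← (show _ = Q from hK), Subgroup.comap_map_eq, QuotientGroup.ker_mk']
  choose L hL using hQ
  have hNL : ∀ N, N.toSubgroup ≤ L N := fun N => by
    obtain ⟨K, hK⟩ := (hL N).exists
    exact hK ▸ le_sup_right
  have hLc : ∀ N, IsClosed (L N : Set G) := fun N =>
    Subgroup.isClosed_of_isOpen _ (Subgroup.isOpen_mono (hNL N) N.isOpen')
  have hmono : ∀ M N : OpenNormalSubgroup G, M.toSubgroup ≤ N.toSubgroup → L M ≤ L N := by
    intro M N hMN
    obtain ⟨K, hK, hK'⟩ := ((hL M).and (hL N)).exists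
    rw [← hK, ← hK']
    exact sup_le_sup_left hMN _
  let H : ClosedSubgroup G := ⟨⨅ N, L N, by
    change IsClosed ((⨅ N, L N : Subgroup G) : Set G)
    rw [Subgroup.coe_iInf]
    exact isClosed_iInter hLc⟩
  refine ⟨H, mem_univ _, (hasBasis_nhds H).ge_iff.2 fun N _ => ?_⟩
  filter_upwards [hL N] with K hK
  change K.toSubgroup ⊔ N.toSubgroup = (⨅ N, L N) ⊔ N.toSubgroup
  rw [hK]
  refine le_antisymm (fun x hx => ?_) (sup_le (iInf_le _ N) (hNL N))
  have hxN : IsClosed ((fun z => x⁻¹ * z) ⁻¹' (N.toSubgroup : Set G)) :=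
    (Subgroup.isClosed_of_isOpen _ N.isOpen').preimage (continuous_const_mul _)
  have hcl : ∀ M, IsClosed (((fun z => x⁻¹ * z) ⁻¹' (N.toSubgroup : Set G)) ∩ (L M : Set G)) :=
    fun M => hxN.inter (hLc M)
  have : Nonempty (OpenNormalSubgroup G) := ⟨N⟩
  obtain ⟨z, hz⟩ := IsCompact.nonempty_iInter_of_directed_nonempty_isCompact_isClosed
    (fun M : OpenNormalSubgroup G =>
      ((fun z => x⁻¹ * z) ⁻¹' (N.toSubgroup : Set G)) ∩ (L M : Set G))
    (fun M M' => ⟨M ⊓ M', inter_subset_inter_right _ (hmono _ _ fun y hy => hy.1),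
      inter_subset_inter_right _ (hmono _ _ fun y hy => hy.2)⟩)
    (fun M => by
      obtain ⟨K', hK', hK''⟩ := ((hL M).and (hL N)).exists
      rw [← hK''] at hx
      obtain ⟨k, hk, n, hn, rfl⟩ := Subgroup.mem_sup_of_normal_right.1 hx
      refine ⟨k, ?_, hK' ▸ Subgroup.mem_sup_left hk⟩
      simpa using hn)
    (fun M => (hcl M).isCompact) hcl
  rw [mem_iInter] at hz
  refine Subgroup.mem_sup_of_normal_right.2 ⟨z, ?_, z⁻¹ * x, ?_, by group⟩
  · exact Subgroup.mem_iInf.2 fun M => (hz M).2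
  · have := N.toSubgroup.inv_mem (hz N).1
    simpa using this

end ClosedSubgroup

/-! ### Procyclic subgroups -/

theorem Subgroup.pow_gcd_mem {G : Type*} [Group G] {H : Subgroup G} {g : G} {i n : ℕ}
    (hi : g ^ i ∈ H) (hn : g ^ n ∈ H) :
    g ^ i.gcd n ∈ H := by
  rw [← zpow_natCast, Nat.gcd_eq_gcd_ab, zpow_add, zpow_mul, zpow_mul, zpow_natCast, zpow_natCast]
  exact mul_mem (zpow_mem hi _) (zpow_mem hn _)

section Procyclic

variable {G : Type*} [Group G] [TopologicalSpace G] [IsTopologicalGroup G]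

/-- The closed subgroup topologically generated by one element. -/
def procyclic (g : G) : Subgroup G := (Subgroup.zpowers g).topologicalClosure

theorem isClosed_procyclic (g : G) : IsClosed (procyclic g : Set G) :=
  Subgroup.isClosed_topologicalClosure _

theorem mem_procyclic_self (g : G) : g ∈ procyclic g :=
  Subgroup.le_topologicalClosure _ (Subgroup.mem_zpowers g)

theorem procyclic_le {H : Subgroup G} (hH : IsClosed (H : Set G)) {g : G} (hg : g ∈ H) :
    procyclic g ≤ H :=
  Subgroup.topologicalClosure_minimal _ (by simpa) hH

theorem procyclic_pow_le (g : G) (n : ℕ) : procyclic (g ^ n) ≤ procyclic g :=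
  procyclic_le (isClosed_procyclic g) (pow_mem (mem_procyclic_self g) n)

theorem procyclic_le_of_dvd (g : G) {m n : ℕ} (h : m ∣ n) :
    procyclic (g ^ n) ≤ procyclic (g ^ m) := by
  obtain ⟨k, rfl⟩ := h
  rw [pow_mul]
  exact procyclic_pow_le _ k

theorem pow_mem_procyclic_pow {g x : G} (hx : x ∈ procyclic g) (n : ℕ) :
    x ^ n ∈ procyclic (g ^ n) := by
  refine map_mem_closure (s := (Subgroup.zpowers g : Set G))
    (t := (Subgroup.zpowers (g ^ n) : Set G)) (continuous_pow n) hx ?_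
  rintro _ ⟨i, rfl⟩
  refine ⟨i, ?_⟩
  change (g ^ n) ^ i = (g ^ i) ^ n
  rw [← zpow_natCast, ← zpow_natCast, ← zpow_mul, ← zpow_mul, mul_comm]

theorem pow_mem_procyclic_mul {g x : G} {m : ℕ} (hx : x ∈ procyclic (g ^ m)) (n : ℕ) :
    x ^ n ∈ procyclic (g ^ (m * n)) :=
  pow_mul g m n ▸ pow_mem_procyclic_pow hx n

theorem commute_of_mem_procyclic [T2Space G] {g x y : G} (hx : x ∈ procyclic g)
    (hy : y ∈ procyclic g) : Commute x y := by
  have hc : ∀ z : G, IsClosed (Subgroup.centralizer {z} : Set G) := fun z =>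
    Set.isClosed_centralizer _
  have h1 : ∀ z ∈ procyclic g, g * z = z * g := fun z hz =>
    Subgroup.mem_centralizer_singleton_iff.1
      (procyclic_le (hc g) (Subgroup.mem_centralizer_singleton_iff.2 rfl) hz) |>.symm
  exact Subgroup.mem_centralizer_singleton_iff.1
    (procyclic_le (hc y) (Subgroup.mem_centralizer_singleton_iff.2 (h1 y hy)) hx)

/-- The powers `1, g, …, g ^ (n - 1)` represent all cosets of `procyclic (g ^ n)` in
`procyclic g`. -/
theorem exists_pow_inv_mul_mem {g x : G} (hx : x ∈ procyclic g) {n : ℕ} (hn : n ≠ 0) :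
    ∃ i < n, (g ^ i)⁻¹ * x ∈ procyclic (g ^ n) := by
  have hcl : IsClosed (⋃ i ∈ Finset.range n,
      (fun x => (g ^ i)⁻¹ * x) ⁻¹' (procyclic (g ^ n) : Set G)) :=
    isClosed_biUnion_finset fun i _ =>
      (isClosed_procyclic _).preimage (continuous_const_mul _)
  have hsub : (Subgroup.zpowers g : Set G) ⊆ ⋃ i ∈ Finset.range n,
      (fun x => (g ^ i)⁻¹ * x) ⁻¹' (procyclic (g ^ n) : Set G) := by
    rintro _ ⟨z, rfl⟩
    have hn' : (n : ℤ) ≠ 0 := by exact_mod_cast hn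
    have h0 := Int.emod_nonneg z hn'
    have h1 := Int.emod_lt_of_pos z (show (0 : ℤ) < n by omega)
    refine mem_iUnion₂.2 ⟨(z % n).toNat, Finset.mem_range.2 (by omega), ?_⟩
    have h2 : (g ^ (z % n).toNat)⁻¹ * g ^ z = (g ^ n) ^ (z / n) := by
      rw [← zpow_natCast, Int.toNat_of_nonneg h0, ← zpow_neg, ← zpow_add, ← zpow_natCast,
        ← zpow_mul]
      congr 1
      have := Int.emod_add_mul_ediv z n
      linarith
    change (g ^ (z % n).toNat)⁻¹ * g ^ z ∈ procyclic (g ^ n)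
    rw [h2]
    exact zpow_mem (mem_procyclic_self _) _
  obtain ⟨i, hi, h⟩ := mem_iUnion₂.1 (closure_minimal hsub hcl hx)
  exact ⟨i, Finset.mem_range.1 hi, h⟩

theorem isOpen_procyclic_pow {g : G} (hg : IsOpen (procyclic g : Set G)) {n : ℕ} (hn : n ≠ 0) :
    IsOpen (procyclic (g ^ n) : Set G) := by
  let B := (procyclic (g ^ n)).subgroupOf (procyclic g)
  have hB : IsClosed (B : Set (procyclic g)) :=
    (isClosed_procyclic _).preimage continuous_subtype_val
  have hs : Function.Surjective fun i : Fin n =>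
      (QuotientGroup.mk ⟨g ^ (i : ℕ), pow_mem (mem_procyclic_self g) _⟩ : procyclic g ⧸ B) := by
    intro q
    obtain ⟨⟨x, hx⟩, rfl⟩ := QuotientGroup.mk_surjective q
    obtain ⟨i, hi, h⟩ := exists_pow_inv_mul_mem hx hn
    exact ⟨⟨i, hi⟩, QuotientGroup.eq.2 h⟩
  have := Finite.of_surjective _ hs
  have : B.FiniteIndex := Subgroup.finiteIndex_of_finite_quotient
  have ho := hg.isOpenMap_subtype_val _ (B.isOpen_of_isClosed_of_finiteIndex hB)
  convert ho using 1
  ext x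
  simp only [SetLike.mem_coe, mem_image, Subtype.exists, exists_and_right, exists_eq_right]
  exact ⟨fun h => ⟨procyclic_pow_le g n h, h⟩, fun ⟨_, h⟩ => h⟩

end Procyclic

section Countable

variable {G : Type*} [Group G] [TopologicalSpace G] [IsTopologicalGroup G]
  [CompactSpace G] [Countable (ClosedSubgroup G)]

/-- A group with countably many closed subgroups is a countable union of procyclic subgroups, so
by Baire's theorem every nonempty open set meets an open procyclic subgroup. -/
theorem exists_isOpen_procyclic_inter {W : Set G} (hW : IsOpen W) (hne : W.Nonempty) :
    ∃ c : G, IsOpen (procyclic c : Set G) ∧ ∃ x ∈ W, x ∈ procyclic c := by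
  let C : Set (ClosedSubgroup G) := range fun c => ⟨procyclic c, isClosed_procyclic c⟩
  have hd : Dense (⋃ H : C, interior (H.1 : Set G)) := by
    refine dense_iUnion_interior_of_closed (fun H => H.1.isClosed') (eq_univ_of_forall fun x => ?_)
    exact mem_iUnion.2 ⟨⟨_, x, rfl⟩, mem_procyclic_self x⟩
  obtain ⟨x, hxW, hx⟩ := hd.inter_open_nonempty W hW hne
  obtain ⟨⟨_, c, rfl⟩, hc⟩ := mem_iUnion.1 hx
  refine ⟨c, ?_, x, hxW, interior_subset hc⟩
  exact Subgroup.isOpen_of_mem_nhds _ (mem_interior_iff_mem_nhds.1 hc)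

theorem isOpen_centralizer_singleton [T2Space G] (g : G) :
    IsOpen (Subgroup.centralizer {g} : Set G) := by
  obtain ⟨c, hc, -⟩ := exists_isOpen_procyclic_inter (G := G) isOpen_univ univ_nonempty
  obtain ⟨d, hd, x, hxc, hxd⟩ := exists_isOpen_procyclic_inter
    (hc.preimage (continuous_const_mul g⁻¹)) ⟨g, by simp [one_mem]⟩
  have ho : IsOpen ((procyclic c ⊓ procyclic d : Subgroup G) : Set G) := hc.inter hd
  refine Subgroup.isOpen_mono (fun y hy => ?_) ho
  rw [Subgroup.mem_centralizer_singleton_iff]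
  have h1 : Commute y x := commute_of_mem_procyclic hy.2 hxd
  have h2 : Commute y (g⁻¹ * x) := commute_of_mem_procyclic hy.1 hxc
  have h3 : Commute y (x * (g⁻¹ * x)⁻¹) := h1.mul_right h2.inv_right
  have h4 : x * (g⁻¹ * x)⁻¹ = g := by group
  rw [h4] at h3
  exact h3

variable (G) in
theorem isOpen_center [T2Space G] : IsOpen (Subgroup.center G : Set G) := by
  obtain ⟨c, hc, -⟩ := exists_isOpen_procyclic_inter (G := G) isOpen_univ univ_nonempty
  have := (procyclic c).quotient_finite_of_isOpen hc
  have ho : IsOpen ((procyclic c : Set G) ∩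
      ⋂ q : G ⧸ procyclic c, (Subgroup.centralizer {q.out} : Set G)) :=
    hc.inter (isOpen_iInter_of_finite fun q => isOpen_centralizer_singleton _)
  have ho' : IsOpen ((procyclic c ⊓
      ⨅ q : G ⧸ procyclic c, Subgroup.centralizer {q.out} : Subgroup G) : Set G) := by
    rwa [Subgroup.coe_inf, Subgroup.coe_iInf]
  refine Subgroup.isOpen_mono (fun y hy => Subgroup.mem_center_iff.2 fun x => ?_) ho'
  have h1 : Commute y (x : G ⧸ procyclic c).out :=
    Subgroup.mem_centralizer_singleton_iff.1 (Subgroup.mem_iInf.1 hy.2 _)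
  have h2 : ((x : G ⧸ procyclic c).out)⁻¹ * x ∈ procyclic c :=
    QuotientGroup.eq.1 (QuotientGroup.out_eq' _)
  have h3 := h1.mul_right (commute_of_mem_procyclic hy.1 h2)
  rw [mul_inv_cancel_left] at h3
  exact h3.eq.symm

variable (G) in
theorem exists_mem_center_isOpen_procyclic [T2Space G] :
    ∃ g ∈ Subgroup.center G, IsOpen (procyclic g : Set G) := by
  obtain ⟨c, hc, -⟩ := exists_isOpen_procyclic_inter (G := G) isOpen_univ univ_nonempty
  have := (Subgroup.center G).quotient_finite_of_isOpen (isOpen_center G)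
  have : (Subgroup.center G).FiniteIndex := Subgroup.finiteIndex_of_finite_quotient
  obtain ⟨n, hn, -, h⟩ := Subgroup.exists_pow_mem_of_index_ne_zero
    (H := Subgroup.center G) Subgroup.FiniteIndex.index_ne_zero c
  exact ⟨c ^ n, h, isOpen_procyclic_pow hc hn.ne'⟩

/-- Only finitely many primes divide the order of `procyclic g`: otherwise the intersections
`⋂ p ∈ S, procyclic (g ^ p)`, for sets `S` of such primes, would be uncountably many distinct
closed subgroups. -/
theorem finite_setOf_procyclic_pow_ne {g : G} (hg : IsOpen (procyclic g : Set G)) :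
    {p : ℕ | p.Prime ∧ procyclic (g ^ p) ≠ procyclic g}.Finite := by
  by_contra hinf
  set P := {p : ℕ | p.Prime ∧ procyclic (g ^ p) ≠ procyclic g} with hP
  have : Infinite P := Set.infinite_coe_iff.2 hinf
  have hdvd : ∀ p ∈ P, ∀ i : ℕ, g ^ i ∈ procyclic (g ^ p) → p ∣ i := by
    intro p hp i hi
    by_contra hpi
    refine hp.2 (le_antisymm (procyclic_pow_le g p) (procyclic_le (isClosed_procyclic _) ?_))
    have := Subgroup.pow_gcd_mem hi (mem_procyclic_self (g ^ p))
    rwa [((Nat.Prime.coprime_iff_not_dvd hp.1).2 hpi).symm, pow_one] at this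
  let B : Set P → Subgroup G := fun S => ⨅ q : S, procyclic (g ^ ((q : P) : ℕ))
  have hBc : ∀ S, IsClosed (B S : Set G) := fun S => by
    rw [Subgroup.coe_iInf]
    exact isClosed_iInter fun q => isClosed_procyclic _
  have hB : ∀ (S : Set P) (p : P), B S ≤ procyclic (g ^ (p : ℕ)) → p ∈ S := by
    intro S p hle
    have ho := isOpen_procyclic_pow hg p.2.1.ne_zero
    obtain ⟨u, hu⟩ := ho.isClosed_compl.isCompact.elim_finite_subfamily_closed
      (fun q : S => (procyclic (g ^ ((q : P) : ℕ)) : Set G)) (fun q => isClosed_procyclic _) (by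
        rw [← Subgroup.coe_iInf, inter_comm, ← Set.sdiff_eq]
        exact sdiff_eq_empty.2 hle)
    have hmem : g ^ (∏ q ∈ u, ((q : P) : ℕ)) ∈ procyclic (g ^ (p : ℕ)) := by
      by_contra hnot
      refine Set.eq_empty_iff_forall_notMem.1 hu _ ⟨hnot, mem_iInter₂.2 fun q hq => ?_⟩
      exact procyclic_le_of_dvd g (Finset.dvd_prod_of_mem (fun q : S => ((q : P) : ℕ)) hq)
        (mem_procyclic_self _)
    obtain ⟨q, hq, hpq⟩ := (p.2.1.prime.dvd_finsetProd_iff _).1 (hdvd p p.2 _ hmem)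
    have : p = q := Subtype.ext ((Nat.prime_dvd_prime_iff_eq p.2.1 q.1.2.1).1 hpq)
    exact this ▸ q.2
  have hinj : Function.Injective fun S => (⟨B S, hBc S⟩ : ClosedSubgroup G) := by
    intro S T hST
    have hST' : B S = B T := congrArg ClosedSubgroup.toSubgroup hST
    exact Set.Subset.antisymm
      (fun p hp => hB T p (hST' ▸ iInf_le (fun q : S => procyclic (g ^ ((q : P) : ℕ))) ⟨p, hp⟩))
      (fun p hp => hB S p (hST' ▸ iInf_le (fun q : T => procyclic (g ^ ((q : P) : ℕ))) ⟨p, hp⟩))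
  have hc : Countable (Set P) := hinj.countable
  obtain ⟨e⟩ := nonempty_equiv_of_countable (α := ℕ) (β := P)
  obtain ⟨f, hf⟩ := exists_injective_nat (Set P)
  exact Function.cantor_injective (e ∘ f) (e.injective.comp hf)

/-- The data carried by a central open procyclic subgroup `procyclic g` that is isomorphic to
`∏ p ∈ π, ℤ_p`; the isomorphism is encoded by saying which of the inclusions
`procyclic (g ^ (n * p)) ≤ procyclic (g ^ n)` are proper. -/
structure IsCentralGenerator (g : G) (π : Finset ℕ) : Prop where
  mem_center : g ∈ Subgroup.center G
  isOpen : IsOpen (procyclic g : Set G)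
  prime : ∀ p ∈ π, p.Prime
  ne : ∀ p ∈ π, ∀ n ≠ 0, procyclic (g ^ (n * p)) ≠ procyclic (g ^ n)
  eq : ∀ p, p.Prime → p ∉ π → ∀ n, procyclic (g ^ (n * p)) = procyclic (g ^ n)

variable (G) in
/-- The finite part of `procyclic g` is removed by choosing `g` so that as few primes as possible
divide the order of `procyclic g`. -/
theorem exists_isCentralGenerator [T2Space G] :
    ∃ (g : G) (π : Finset ℕ), IsCentralGenerator g π := by
  let P : G → Set ℕ := fun g => {p : ℕ | p.Prime ∧ procyclic (g ^ p) ≠ procyclic g}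
  let S := {g : G // g ∈ Subgroup.center G ∧ IsOpen (procyclic g : Set G)}
  have hfin : ∀ g : S, (P g).Finite := fun g => finite_setOf_procyclic_pow_ne g.2.2
  have : Nonempty S := by
    obtain ⟨g, h⟩ := exists_mem_center_isOpen_procyclic G
    exact ⟨⟨g, h⟩⟩
  obtain ⟨⟨g, hgc, hgo⟩, hmin⟩ : ∃ g : S, ∀ h : S, (P g).ncard ≤ (P h).ncard :=
    ⟨Function.argmin fun g : S => (P g).ncard,
      fun h => Function.argmin_le (fun g : S => (P g).ncard) h⟩
  have heq : ∀ p, procyclic (g ^ p) = procyclic g → ∀ n,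
      procyclic (g ^ (n * p)) = procyclic (g ^ n) := by
    intro p hp n
    refine le_antisymm (procyclic_le_of_dvd g (dvd_mul_right n p))
      (procyclic_le (isClosed_procyclic _) ?_)
    rw [mul_comm]
    exact pow_mem_procyclic_mul (hp ▸ mem_procyclic_self g) n
  have hg := hfin ⟨g, hgc, hgo⟩
  refine ⟨g, hg.toFinset, hgc, hgo, fun p hp => (hg.mem_toFinset.1 hp).1, ?_, ?_⟩
  · intro p hp n hn
    let h : S := ⟨g ^ n, pow_mem hgc n, isOpen_procyclic_pow hgo hn⟩
    have hsub : P h ⊆ P g := fun q hq =>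
      ⟨hq.1, fun hq' => hq.2 (by simpa [h, ← pow_mul] using heq q hq' n)⟩
    have := Set.eq_of_subset_of_ncard_le hsub (hmin h) hg
    have hpn : p ∈ P h := this ▸ hg.mem_toFinset.1 hp
    rw [pow_mul]
    exact hpn.2
  · intro p hp hpn n
    refine heq p ?_ n
    by_contra hne
    exact hpn (hg.mem_toFinset.2 ⟨hp, hne⟩)

end Countable

/-! ### Closed subgroups of the central open procyclic subgroup -/

namespace IsCentralGenerator

variable {G : Type*} [Group G] [TopologicalSpace G] [IsTopologicalGroup G] {g : G} {π : Finset ℕ}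

theorem pow_mem_procyclic_pow_iff (hg : IsCentralGenerator g π) {n : ℕ} (hn : n ≠ 0)
    (hnπ : n.primeFactors ⊆ π) {i : ℕ} : g ^ i ∈ procyclic (g ^ n) ↔ n ∣ i := by
  refine ⟨fun hi => ?_, fun h => procyclic_le_of_dvd g h (mem_procyclic_self _)⟩
  have hd := Subgroup.pow_gcd_mem hi (mem_procyclic_self (g ^ n))
  obtain ⟨e, he⟩ := Nat.gcd_dvd_right i n
  have hd0 : i.gcd n ≠ 0 := fun h => hn (by rw [he, h, zero_mul])
  by_cases he1 : e = 1
  · rw [he1, mul_one] at he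
    exact he ▸ Nat.gcd_dvd_left i n
  · exfalso
    have hp := Nat.minFac_prime he1
    have hpe : i.gcd n * e.minFac ∣ n := by
      conv_rhs => rw [he]
      exact mul_dvd_mul_left _ e.minFac_dvd
    have hpπ : e.minFac ∈ π :=
      hnπ (Nat.mem_primeFactors.2 ⟨hp, (dvd_mul_left _ _).trans hpe, hn⟩)
    refine hg.ne _ hpπ _ hd0 (le_antisymm (procyclic_le_of_dvd g (dvd_mul_right _ _)) ?_)
    exact (procyclic_le (isClosed_procyclic _) hd).trans (procyclic_le_of_dvd g hpe)

/-- Every element of `procyclic g` agrees with a power of `g` to any given precision. -/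
theorem exists_forall_dvd (hg : IsCentralGenerator g π) {a : G} (ha : a ∈ procyclic g) {n : ℕ}
    (hn : n ≠ 0) (hnπ : n.primeFactors ⊆ π) :
    ∃ i : ℕ, (g ^ i)⁻¹ * a ∈ procyclic (g ^ n) ∧ ∀ d, d ∣ n → (a ∈ procyclic (g ^ d) ↔ d ∣ i) := by
  obtain ⟨i, -, hi⟩ := exists_pow_inv_mul_mem ha hn
  refine ⟨i, hi, fun d hd => ?_⟩
  rw [← hg.pow_mem_procyclic_pow_iff (ne_zero_of_dvd_ne_zero hn hd)
    ((Nat.primeFactors_mono hd hn).trans hnπ)]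
  have h := procyclic_le_of_dvd g hd hi
  have h' : a = g ^ i * ((g ^ i)⁻¹ * a) := by group
  rw [h', Subgroup.mul_mem_cancel_right _ h]

theorem mem_of_forall_prime_pow (hg : IsCentralGenerator g π) {a : G} (ha : a ∈ procyclic g)
    {n : ℕ} (hn : n ≠ 0) (hnπ : n.primeFactors ⊆ π)
    (h : ∀ p ∈ π, ∀ j, p ^ j ∣ n → a ∈ procyclic (g ^ p ^ j)) : a ∈ procyclic (g ^ n) := by
  obtain ⟨i, -, hi⟩ := hg.exists_forall_dvd ha hn hnπ
  rw [hi n dvd_rfl, Nat.dvd_iff_prime_pow_dvd_dvd]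
  intro p j hp hj
  rcases j with _ | j
  · simp
  · have hpπ : p ∈ π :=
      hnπ (Nat.mem_primeFactors.2 ⟨hp, (dvd_pow_self p j.succ_ne_zero).trans hj, hn⟩)
    exact (hi _ hj).1 (h p hpπ _ hj)

theorem primeFactors_prime_pow_subset (hg : IsCentralGenerator g π) {p : ℕ} (hp : p ∈ π) (j : ℕ) :
    (p ^ j).primeFactors ⊆ π :=
  fun q hq => by
    have hqp := Nat.prime_of_mem_primeFactors hq
    have := hqp.dvd_of_dvd_pow (Nat.dvd_of_mem_primeFactors hq)
    rwa [(Nat.prime_dvd_prime_iff_eq hqp (hg.prime p hp)).1 this]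

/-- Roots exist up to bounded precision, since `procyclic g` has no torsion. -/
theorem mem_of_pow_mem (hg : IsCentralGenerator g π) {a : G} (ha : a ∈ procyclic g) {m p j : ℕ}
    (hm : m ≠ 0) (hp : p ∈ π) (h : a ^ m ∈ procyclic (g ^ p ^ (j + m))) :
    a ∈ procyclic (g ^ p ^ j) := by
  have hpp := hg.prime p hp
  have hn : p ^ (j + m) ≠ 0 := pow_ne_zero _ hpp.ne_zero
  obtain ⟨i, hi, hid⟩ := hg.exists_forall_dvd ha hn (hg.primeFactors_prime_pow_subset hp _)
  rw [hid _ (pow_dvd_pow p (Nat.le_add_right j m))]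
  have hc : Commute (g ^ i) ((g ^ i)⁻¹ * a) :=
    ((Subgroup.mem_center_iff.1 (pow_mem hg.mem_center i) ((g ^ i)⁻¹ * a)).symm :)
  have h1 : a ^ m = g ^ (i * m) * ((g ^ i)⁻¹ * a) ^ m := by
    rw [pow_mul, ← hc.mul_pow, mul_inv_cancel_left]
  rw [h1, Subgroup.mul_mem_cancel_right _ (pow_mem hi m),
    hg.pow_mem_procyclic_pow_iff hn (hg.primeFactors_prime_pow_subset hp _)] at h
  obtain ⟨v, m', hm', hmv⟩ := Nat.exists_eq_pow_mul_and_not_dvd hm p hpp.ne_one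
  rw [hmv, ← mul_assoc] at h
  have h2 := hpp.prime.pow_dvd_of_dvd_mul_right _ hm' h
  rw [← hmv] at h2
  have hv : v ≤ m := (Nat.lt_pow_self hpp.one_lt).le.trans
    (Nat.le_of_dvd (Nat.pos_of_ne_zero hm) ⟨m', hmv⟩)
  have h3 : p ^ j * p ^ v ∣ i * p ^ v := by
    rw [← pow_add]
    exact (pow_dvd_pow p (by omega)).trans h2
  exact Nat.dvd_of_mul_dvd_mul_right (pow_pos hpp.pos v) h3

theorem exists_primeFactors_subset (hg : IsCentralGenerator g π) {n : ℕ} (hn : n ≠ 0) :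
    ∃ m ≠ 0, m.primeFactors ⊆ π ∧ procyclic (g ^ m) = procyclic (g ^ n) := by
  induction n using Nat.strong_induction_on with
  | _ n ih =>
    by_cases h : n.primeFactors ⊆ π
    · exact ⟨n, hn, h, rfl⟩
    · obtain ⟨q, hq, hqπ⟩ := Finset.not_subset.1 h
      have hqp := Nat.prime_of_mem_primeFactors hq
      obtain ⟨m, rfl⟩ := Nat.dvd_of_mem_primeFactors hq
      have hm : m ≠ 0 := right_ne_zero_of_mul hn
      obtain ⟨m', h1, h2, h3⟩ := ih m (by
        have := hqp.two_le
        have := Nat.pos_of_ne_zero hm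
        nlinarith) hm
      refine ⟨m', h1, h2, ?_⟩
      rw [h3, mul_comm, hg.eq q hqp hqπ]

theorem procyclic_le_center [T2Space G] (hg : IsCentralGenerator g π) :
    procyclic g ≤ Subgroup.center G := fun x hx => Subgroup.mem_center_iff.2 fun z => by
  have h : procyclic g ≤ Subgroup.centralizer {z} :=
    procyclic_le (Set.isClosed_centralizer _) (Subgroup.mem_centralizer_singleton_iff.2
      (Subgroup.mem_center_iff.1 hg.mem_center z).symm)
  exact (Subgroup.mem_centralizer_singleton_iff.1 (h hx)).symm

theorem normal_of_le [T2Space G] (hg : IsCentralGenerator g π) {H : Subgroup G}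
    (hH : H ≤ procyclic g) : H.Normal :=
  ⟨fun x hx z => by
    rwa [Subgroup.mem_center_iff.1 (hg.procyclic_le_center (hH hx)) z, mul_inv_cancel_right]⟩

/-- The open normal subgroup of `n`-th powers in `procyclic g`. -/
def openNormalSubgroup [T2Space G] (hg : IsCentralGenerator g π) (n : ℕ) (hn : n ≠ 0) :
    OpenNormalSubgroup G :=
  ⟨⟨procyclic (g ^ n), isOpen_procyclic_pow hg.isOpen hn⟩, hg.normal_of_le (procyclic_pow_le g n)⟩

variable [CompactSpace G]

theorem exists_eq_procyclic_pow (hg : IsCentralGenerator g π) {U : Subgroup G}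
    (hU : IsOpen (U : Set G)) (hUg : U ≤ procyclic g) :
    ∃ n ≠ 0, n.primeFactors ⊆ π ∧ U = procyclic (g ^ n) := by
  classical
  have hcl := U.isClosed_of_isOpen hU
  have := U.quotient_finite_of_isOpen hU
  have : U.FiniteIndex := Subgroup.finiteIndex_of_finite_quotient
  have hex : ∃ n, n ≠ 0 ∧ g ^ n ∈ U := by
    obtain ⟨n, hn, -, h⟩ := Subgroup.exists_pow_mem_of_index_ne_zero
      (H := U) Subgroup.FiniteIndex.index_ne_zero g
    exact ⟨n, hn.ne', h⟩
  obtain ⟨hn, hgn⟩ := Nat.find_spec hex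
  obtain ⟨m, hm, hmπ, hmn⟩ := hg.exists_primeFactors_subset hn
  refine ⟨m, hm, hmπ, ?_⟩
  rw [hmn]
  have hle := procyclic_le hcl hgn
  refine le_antisymm (fun u hu => ?_) hle
  obtain ⟨i, hi, h⟩ := exists_pow_inv_mul_mem (hUg hu) hn
  have hiU : g ^ i ∈ U := by
    have := mul_mem hu (inv_mem (hle h))
    rwa [mul_inv_rev, inv_inv, mul_inv_cancel_left] at this
  have hi0 : i = 0 := by
    by_contra hi0
    exact Nat.find_min hex hi ⟨hi0, hiU⟩
  simpa [hi0] using h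

variable [TotallyDisconnectedSpace G]

/-- A closed subgroup of `∏ p ∈ π, ℤ_p` is determined by the `p`-parts of its index. -/
theorem mem_of_forall_le (hg : IsCentralGenerator g π) {B : Subgroup G}
    (hB : IsClosed (B : Set G)) (hBg : B ≤ procyclic g) {a : G} (ha : a ∈ procyclic g)
    (h : ∀ p ∈ π, ∀ j, B ≤ procyclic (g ^ p ^ j) → a ∈ procyclic (g ^ p ^ j)) : a ∈ B := by
  refine ClosedSubgroup.mem_of_forall_mem_sup hB fun N => ?_
  have hU : IsOpen (((B ⊔ N.toSubgroup) ⊓ procyclic g : Subgroup G) : Set G) :=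
    (Subgroup.isOpen_mono le_sup_right N.isOpen').inter hg.isOpen
  obtain ⟨n, hn, hnπ, hUn⟩ := hg.exists_eq_procyclic_pow hU inf_le_right
  have hBn : B ≤ procyclic (g ^ n) := hUn ▸ le_inf le_sup_left hBg
  have han : a ∈ procyclic (g ^ n) := hg.mem_of_forall_prime_pow ha hn hnπ fun p hp j hj =>
    h p hp j (hBn.trans (procyclic_le_of_dvd g hj))
  rw [← hUn] at han
  exact han.1

/-! ### The primes of infinite exponent -/

theorem not_dvd_relIndex (hg : IsCentralGenerator g π) {p n : ℕ} (hp : p.Prime) (hpπ : p ∉ π)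
    (hn : n ≠ 0) (hnπ : n.primeFactors ⊆ π) :
    ¬ p ∣ (procyclic (g ^ n)).relIndex (procyclic g) := by
  intro hdvd
  have := hg.normal_of_le (procyclic_pow_le g n)
  let B := (procyclic (g ^ n)).subgroupOf (procyclic g)
  have hB : IsOpen (B : Set (procyclic g)) :=
    (isOpen_procyclic_pow hg.isOpen hn).preimage continuous_subtype_val
  have : CompactSpace (procyclic g) :=
    isCompact_iff_compactSpace.1 (isClosed_procyclic g).isCompact
  have := B.quotient_finite_of_isOpen hB
  have : Fact p.Prime := ⟨hp⟩
  obtain ⟨q, hq⟩ := exists_prime_orderOf_dvd_card' (G := procyclic g ⧸ B) p hdvd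
  obtain ⟨⟨x, hx⟩, rfl⟩ := QuotientGroup.mk_surjective q
  obtain ⟨i, hi, hid⟩ := hg.exists_forall_dvd hx hn hnπ
  have h1 : x ^ p ∈ procyclic (g ^ n) := by
    have := pow_orderOf_eq_one (QuotientGroup.mk ⟨x, hx⟩ : procyclic g ⧸ B)
    rw [hq, ← QuotientGroup.mk_pow, QuotientGroup.eq_one_iff] at this
    exact this
  have hc : Commute (g ^ i) ((g ^ i)⁻¹ * x) :=
    ((Subgroup.mem_center_iff.1 (pow_mem hg.mem_center i) ((g ^ i)⁻¹ * x)).symm :)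
  have h2 : x ^ p = g ^ (i * p) * ((g ^ i)⁻¹ * x) ^ p := by
    rw [pow_mul, ← hc.mul_pow, mul_inv_cancel_left]
  rw [h2, Subgroup.mul_mem_cancel_right _ (pow_mem hi p),
    hg.pow_mem_procyclic_pow_iff hn hnπ] at h1
  have hcop : n.Coprime p := ((hp.coprime_iff_not_dvd).2 fun h =>
    hpπ (hnπ (Nat.mem_primeFactors.2 ⟨hp, h, hn⟩))).symm
  have hxn : x ∈ procyclic (g ^ n) := (hid n dvd_rfl).2 (hcop.dvd_of_dvd_mul_right h1)
  have h3 : (QuotientGroup.mk ⟨x, hx⟩ : procyclic g ⧸ B) = 1 :=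
    (QuotientGroup.eq_one_iff _).2 hxn
  rw [h3, orderOf_one] at hq
  exact hp.ne_one hq.symm

theorem profiniteOrder_eq_top_iff (hg : IsCentralGenerator g π) (p : Nat.Primes) :
    profiniteOrder G p = ⊤ ↔ (p : ℕ) ∈ π := by
  constructor
  · intro htop
    by_contra hpπ
    have := (procyclic g).quotient_finite_of_isOpen hg.isOpen
    have : (procyclic g).FiniteIndex := Subgroup.finiteIndex_of_finite_quotient
    have hle : profiniteOrder G p ≤ emultiplicity (p : ℕ) (procyclic g).index := by
      refine iSup_le fun N => ?_
      obtain ⟨n, hn, hnπ, hUn⟩ := hg.exists_eq_procyclic_pow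
        (U := N.toSubgroup ⊓ procyclic g) (N.isOpen'.inter hg.isOpen) inf_le_right
      refine (emultiplicity_le_emultiplicity_of_dvd_right
        (Subgroup.index_dvd_of_le (inf_le_left : N.toSubgroup ⊓ procyclic g ≤ _))).trans ?_
      rw [hUn, ← Subgroup.relIndex_mul_index (procyclic_pow_le g n), p.2.emultiplicity_mul,
        emultiplicity_eq_zero.2 (hg.not_dvd_relIndex p.2 hpπ hn hnπ), zero_add]
    rw [htop, top_le_iff, emultiplicity_eq_top, Nat.finiteMultiplicity_iff] at hle
    exact hle ⟨p.2.ne_one, Nat.pos_of_ne_zero Subgroup.FiniteIndex.index_ne_zero⟩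
  · intro hp
    refine ENat.eq_top_iff_forall_ge.2 fun j => ?_
    have hn : (p : ℕ) ^ j ≠ 0 := pow_ne_zero _ p.2.ne_zero
    let N := hg.openNormalSubgroup _ hn
    refine le_trans (pow_dvd_iff_le_emultiplicity.1 ?_)
      (le_iSup (fun N : OpenNormalSubgroup G => emultiplicity (p : ℕ) N.toSubgroup.index) N)
    refine dvd_trans ?_ (_root_.orderOf_dvd_natCard (g : G ⧸ N.toSubgroup))
    rw [← hg.pow_mem_procyclic_pow_iff hn (hg.primeFactors_prime_pow_subset hp j)]
    have := pow_orderOf_eq_one (g : G ⧸ N.toSubgroup)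
    rw [← QuotientGroup.mk_pow, QuotientGroup.eq_one_iff] at this
    exact this

theorem image_infinitePrimes (hg : IsCentralGenerator g π) :
    (fun p : Nat.Primes => (p : ℕ)) '' infinitePrimes G = π := by
  ext p
  constructor
  · rintro ⟨p, hp, rfl⟩
    exact (hg.profiniteOrder_eq_top_iff p).1 hp
  · intro hp
    exact ⟨⟨p, hg.prime p hp⟩, (hg.profiniteOrder_eq_top_iff _).2 hp, rfl⟩

theorem finite_infinitePrimes (hg : IsCentralGenerator g π) : (infinitePrimes G).Finite :=
  Set.Finite.of_finite_image (hg.image_infinitePrimes ▸ π.finite_toSet)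
    Subtype.val_injective.injOn

theorem ncard_infinitePrimes (hg : IsCentralGenerator g π) : (infinitePrimes G).ncard = π.card := by
  rw [← Set.ncard_image_of_injective (infinitePrimes G) Subtype.val_injective]
  exact (congrArg Set.ncard hg.image_infinitePrimes).trans (Set.ncard_coe_finset π)

end IsCentralGenerator

/-! ### The rank of a closed subgroup -/

open Classical in
/-- The primes `p ∈ π` for which the intersection of `H` with `procyclic g ≃ ∏ p ∈ π, ℤ_p` has
trivial `p`-component, that is, `H ⊓ procyclic g` consists of elements that are `p ^ j`-th powers
for all `j`. -/
noncomputable def trivialPrimes {G : Type*} [Group G] [TopologicalSpace G] [IsTopologicalGroup G]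
    (g : G) (π : Finset ℕ) (H : ClosedSubgroup G) : Finset ℕ :=
  π.filter fun p => ∀ j, H.toSubgroup ⊓ procyclic g ≤ procyclic (g ^ p ^ j)

namespace IsCentralGenerator

variable {G : Type*} [Group G] [TopologicalSpace G] [IsTopologicalGroup G] {g : G} {π : Finset ℕ}

theorem mem_trivialPrimes {H : ClosedSubgroup G} {p : ℕ} : p ∈ trivialPrimes g π H ↔
    p ∈ π ∧ ∀ j, H.toSubgroup ⊓ procyclic g ≤ procyclic (g ^ p ^ j) := by
  classical
  exact Finset.mem_filter

theorem inf_procyclic_le_of_sup_eq [T2Space G] (hg : IsCentralGenerator g π) {H K : Subgroup G}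
    {n d : ℕ} (hd : d ∣ n) (h : K ≤ H ⊔ procyclic (g ^ n))
    (hH : H ⊓ procyclic g ≤ procyclic (g ^ d)) : K ⊓ procyclic g ≤ procyclic (g ^ d) := by
  have := hg.normal_of_le (procyclic_pow_le g n)
  rintro x ⟨hxK, hx⟩
  obtain ⟨y, hy, z, hz, rfl⟩ := Subgroup.mem_sup_of_normal_right.1 (h hxK)
  exact mul_mem (hH ⟨hy, (Subgroup.mul_mem_cancel_right _ (procyclic_pow_le g n hz)).1 hx⟩)
    (procyclic_le_of_dvd g hd hz)

variable [CompactSpace G]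

/-- Small subgroups with a single nontrivial component: `y` is a nontrivial element of the
`p`-component of `procyclic (g ^ n)`. -/
theorem exists_mem_forall_mem_procyclic (hg : IsCentralGenerator g π) {p n : ℕ} (hp : p ∈ π)
    (hn : n ≠ 0) (hnπ : n.primeFactors ⊆ π) :
    ∃ y ∈ procyclic (g ^ n), (∀ q ∈ π, q ≠ p → ∀ j, y ∈ procyclic (g ^ q ^ j)) ∧
      ∃ j, y ∉ procyclic (g ^ p ^ j) := by
  have hpp := hg.prime p hp
  have hnp : n * p ≠ 0 := mul_ne_zero hn hpp.ne_zero
  have hnpπ : (n * p).primeFactors ⊆ π := by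
    rw [Nat.primeFactors_mul hn hpp.ne_zero, hpp.primeFactors]
    exact Finset.union_subset hnπ (by simpa using hp)
  let s := ∏ q ∈ π.erase p, q
  have hps : ¬ p ∣ s := fun h => by
    obtain ⟨q, hq, hpq⟩ := (hpp.prime.dvd_finsetProd_iff _).1 h
    exact (Finset.mem_erase.1 hq).1
      ((Nat.prime_dvd_prime_iff_eq hpp (hg.prime q (Finset.mem_of_mem_erase hq))).1 hpq).symm
  have hcl : ∀ i, IsClosed ((procyclic (g ^ (n * s ^ i)) : Set G) \ procyclic (g ^ (n * p))) :=
    fun i => (isClosed_procyclic _).sdiff (isOpen_procyclic_pow hg.isOpen hnp)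
  obtain ⟨y, hy⟩ := IsCompact.nonempty_iInter_of_sequence_nonempty_isCompact_isClosed
    (fun i => (procyclic (g ^ (n * s ^ i)) : Set G) \ procyclic (g ^ (n * p)))
    (fun i => sdiff_subset_sdiff_left
      (procyclic_le_of_dvd g (mul_dvd_mul_left n (pow_dvd_pow s i.le_succ))))
    (fun i => ⟨g ^ (n * s ^ i), mem_procyclic_self _, fun h => by
      rw [SetLike.mem_coe, hg.pow_mem_procyclic_pow_iff hnp hnpπ] at h
      exact hps (hpp.dvd_of_dvd_pow (Nat.dvd_of_mul_dvd_mul_left (Nat.pos_of_ne_zero hn) h))⟩)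
    (hcl 0).isCompact hcl
  rw [mem_iInter] at hy
  have hyn : y ∈ procyclic (g ^ n) := procyclic_le_of_dvd g (dvd_mul_right n _) (hy 0).1
  have hyq : ∀ q ∈ π, q ≠ p → ∀ j, y ∈ procyclic (g ^ q ^ j) := fun q hq hqp j =>
    procyclic_le_of_dvd g ((pow_dvd_pow_of_dvd
      (Finset.dvd_prod_of_mem (fun q => q) (Finset.mem_erase.2 ⟨hqp, hq⟩)) j).trans
        (dvd_mul_left _ n)) (hy j).1
  refine ⟨y, hyn, hyq, ?_⟩
  by_contra! h
  refine (hy 0).2 (hg.mem_of_forall_prime_pow (procyclic_pow_le g n hyn) hnp hnpπ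
    fun q hq j _ => ?_)
  by_cases hqp : q = p
  · exact hqp ▸ h j
  · exact hyq q hq hqp j

variable [TotallyDisconnectedSpace G]

/-- If `H` and `K` meet `procyclic g` in the same subgroup `B` and `H ≤ KN` for
`N = procyclic (g ^ n)`, then `H ≤ K`, provided that `n` is divisible enough. For if
`h = k * a` with `a ∈ N`, then `a ^ m ∈ B` for the index `m` of the central subgroup `procyclic g`;
this controls the components of `a` at the primes where `B` is trivial, and the choice of `n`
controls the others. -/
theorem le_of_le_sup (hg : IsCentralGenerator g π) {H K : Subgroup G}
    (hK : IsClosed (K : Set G)) {n : ℕ} (hHK : H ⊓ procyclic g = K ⊓ procyclic g)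
    (h : H ≤ K ⊔ procyclic (g ^ n))
    (hn : ∀ p ∈ π, (∀ j, K ⊓ procyclic g ≤ procyclic (g ^ p ^ j)) ∨
      ∃ e, ¬ K ⊓ procyclic g ≤ procyclic (g ^ p ^ e) ∧ p ^ e ∣ n) : H ≤ K := by
  intro x hx
  have := hg.normal_of_le (procyclic_pow_le g n)
  have := hg.normal_of_le le_rfl
  have := (procyclic g).quotient_finite_of_isOpen hg.isOpen
  have : (procyclic g).FiniteIndex := Subgroup.finiteIndex_of_finite_quotient
  have hm : (procyclic g).index ≠ 0 := Subgroup.FiniteIndex.index_ne_zero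
  obtain ⟨k, hk, a, ha, rfl⟩ := Subgroup.mem_sup_of_normal_right.1 (h hx)
  have hag := procyclic_pow_le g n ha
  have hc : Commute k a := Subgroup.mem_center_iff.1 (hg.procyclic_le_center hag) k
  have ham : a ^ (procyclic g).index ∈ K ⊓ procyclic g := by
    have h1 : (k * a) ^ (procyclic g).index ∈ K ⊓ procyclic g :=
      hHK ▸ ⟨pow_mem hx _, (procyclic g).pow_index_mem _⟩
    have h2 : k ^ (procyclic g).index ∈ K ⊓ procyclic g :=
      ⟨pow_mem hk _, (procyclic g).pow_index_mem _⟩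
    rwa [hc.mul_pow, Subgroup.mul_mem_cancel_left _ h2] at h1
  have haB : a ∈ K ⊓ procyclic g := by
    refine hg.mem_of_forall_le (hK.inter (isClosed_procyclic g)) inf_le_right hag
      fun p hp j hj => ?_
    rcases hn p hp with htriv | ⟨e, he, hen⟩
    · exact hg.mem_of_pow_mem hag hm hp (htriv _ ham)
    · have hje : j ≤ e := by
        by_contra hej
        exact he (hj.trans (procyclic_le_of_dvd g (pow_dvd_pow p (by omega))))
      exact procyclic_le_of_dvd g ((pow_dvd_pow p hje).trans hen) ha
  exact mul_mem hk haB.1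

theorem eventually_trivialPrimes_ssubset (hg : IsCentralGenerator g π) (H : ClosedSubgroup G) :
    ∀ᶠ K in 𝓝 H, K ≠ H → trivialPrimes g π K ⊂ trivialPrimes g π H := by
  have hex : ∀ p, ∃ e, p ∈ π → p ∉ trivialPrimes g π H →
      ¬ H.toSubgroup ⊓ procyclic g ≤ procyclic (g ^ p ^ e) := by
    intro p
    by_cases h : p ∈ π ∧ p ∉ trivialPrimes g π H
    · have h2 := h.2
      rw [mem_trivialPrimes] at h2
      push Not at h2
      obtain ⟨e, he⟩ := h2 h.1
      exact ⟨e, fun _ _ => he⟩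
    · exact ⟨0, fun h1 h2 => absurd ⟨h1, h2⟩ h⟩
  choose e he using hex
  have hn : ∏ p ∈ π, p ^ e p ≠ 0 :=
    Finset.prod_ne_zero_iff.2 fun p hp => pow_ne_zero _ (hg.prime p hp).ne_zero
  have hdvd : ∀ p ∈ π, p ^ e p ∣ ∏ p ∈ π, p ^ e p := fun p hp =>
    Finset.dvd_prod_of_mem (fun p => p ^ e p) hp
  refine (ClosedSubgroup.hasBasis_nhds H).eventually_iff.2
    ⟨hg.openNormalSubgroup _ hn, trivial, fun K hK hne => ?_⟩
  have hK' : K.toSubgroup ⊔ procyclic (g ^ ∏ p ∈ π, p ^ e p) =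
      H.toSubgroup ⊔ procyclic (g ^ ∏ p ∈ π, p ^ e p) := hK
  have hKH : K.toSubgroup ≤ H.toSubgroup ⊔ procyclic (g ^ ∏ p ∈ π, p ^ e p) :=
    hK' ▸ le_sup_left
  have hHK : H.toSubgroup ≤ K.toSubgroup ⊔ procyclic (g ^ ∏ p ∈ π, p ^ e p) :=
    hK' ▸ le_sup_left
  have hKe : ∀ p ∈ π, p ∉ trivialPrimes g π H →
      ¬ K.toSubgroup ⊓ procyclic g ≤ procyclic (g ^ p ^ e p) := fun p hp hpH h =>
    he p hp hpH (hg.inf_procyclic_le_of_sup_eq (hdvd p hp) hHK h)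
  have hsub : trivialPrimes g π K ⊆ trivialPrimes g π H := fun p hp => by
    by_contra hpH
    have h := mem_trivialPrimes.1 hp
    exact hKe p h.1 hpH (h.2 _)
  refine hsub.ssubset_of_ne fun heq => hne ?_
  have hiff : ∀ p ∈ π, ∀ j, K.toSubgroup ⊓ procyclic g ≤ procyclic (g ^ p ^ j) ↔
      H.toSubgroup ⊓ procyclic g ≤ procyclic (g ^ p ^ j) := by
    intro p hp j
    by_cases hpH : p ∈ trivialPrimes g π H
    · exact iff_of_true ((mem_trivialPrimes.1 (heq ▸ hpH)).2 j) ((mem_trivialPrimes.1 hpH).2 j)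
    · by_cases hj : j ≤ e p
      · have hd := (pow_dvd_pow p hj).trans (hdvd p hp)
        exact ⟨hg.inf_procyclic_le_of_sup_eq hd hHK, hg.inf_procyclic_le_of_sup_eq hd hKH⟩
      · have hle := procyclic_le_of_dvd g (pow_dvd_pow p (show e p ≤ j by omega))
        exact iff_of_false (fun h => hKe p hp hpH (h.trans hle))
          (fun h => he p hp hpH (h.trans hle))
  have hB : K.toSubgroup ⊓ procyclic g = H.toSubgroup ⊓ procyclic g := by
    refine le_antisymm (fun x hx => ?_) fun x hx => ?_
    · exact hg.mem_of_forall_le (H.isClosed'.inter (isClosed_procyclic g)) inf_le_right hx.2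
        fun p hp j hj => (hiff p hp j).2 hj hx
    · exact hg.mem_of_forall_le (K.isClosed'.inter (isClosed_procyclic g)) inf_le_right hx.2
        fun p hp j hj => (hiff p hp j).1 hj hx
  refine ClosedSubgroup.toSubgroup_injective (le_antisymm ?_ ?_)
  · refine hg.le_of_le_sup H.isClosed' hB hKH fun p hp => ?_
    by_cases hpH : p ∈ trivialPrimes g π H
    · exact Or.inl (mem_trivialPrimes.1 hpH).2
    · exact Or.inr ⟨e p, he p hp hpH, hdvd p hp⟩
  · refine hg.le_of_le_sup K.isClosed' hB.symm hHK fun p hp => ?_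
    by_cases hpH : p ∈ trivialPrimes g π H
    · exact Or.inl (mem_trivialPrimes.1 (heq ▸ hpH)).2
    · exact Or.inr ⟨e p, hKe p hp hpH, hdvd p hp⟩

theorem frequently_trivialPrimes_eq_erase (hg : IsCentralGenerator g π) (H : ClosedSubgroup G)
    {p : ℕ} (hp : p ∈ trivialPrimes g π H) :
    ∃ᶠ K in 𝓝 H, trivialPrimes g π K = (trivialPrimes g π H).erase p := by
  rw [(ClosedSubgroup.hasBasis_nhds H).frequently_iff]
  intro N _
  obtain ⟨n, hn, hnπ, hUn⟩ := hg.exists_eq_procyclic_pow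
    (U := N.toSubgroup ⊓ procyclic g) (N.isOpen'.inter hg.isOpen) inf_le_right
  obtain ⟨y, hyn, hyq, j, hyj⟩ := hg.exists_mem_forall_mem_procyclic
    (mem_trivialPrimes.1 hp).1 hn hnπ
  have hyN : y ∈ N.toSubgroup := by
    rw [← hUn] at hyn
    exact hyn.1
  have hyg : y ∈ procyclic g := procyclic_pow_le g n hyn
  have hle : procyclic y ≤ procyclic g := procyclic_le (isClosed_procyclic g) hyg
  have hleN : procyclic y ≤ N.toSubgroup :=
    procyclic_le (Subgroup.isClosed_of_isOpen _ N.isOpen') hyN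
  have := hg.normal_of_le hle
  let K : ClosedSubgroup G := ⟨H.toSubgroup ⊔ procyclic y, by
    change IsClosed ((H.toSubgroup ⊔ procyclic y : Subgroup G) : Set G)
    rw [Subgroup.mul_normal]
    have hH : IsClosed (H.toSubgroup : Set G) := H.isClosed'
    exact (hH.isCompact.mul (isClosed_procyclic y).isCompact).isClosed⟩
  have hKle : ∀ d, K.toSubgroup ⊓ procyclic g ≤ procyclic (g ^ d) ↔
      H.toSubgroup ⊓ procyclic g ≤ procyclic (g ^ d) ∧ y ∈ procyclic (g ^ d) := by
    intro d
    constructor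
    · intro h
      exact ⟨fun x hx => h ⟨Subgroup.mem_sup_left hx.1, hx.2⟩,
        h ⟨Subgroup.mem_sup_right (mem_procyclic_self y), hyg⟩⟩
    · rintro ⟨h1, h2⟩ x ⟨hxK, hx⟩
      obtain ⟨a, ha, b, hb, rfl⟩ := Subgroup.mem_sup_of_normal_right.1 hxK
      exact mul_mem (h1 ⟨ha, (Subgroup.mul_mem_cancel_right _ (hle hb)).1 hx⟩)
        (procyclic_le (isClosed_procyclic _) h2 hb)
  refine ⟨K, ?_, ?_⟩
  · change (H.toSubgroup ⊔ procyclic y) ⊔ N.toSubgroup = H.toSubgroup ⊔ N.toSubgroup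
    rw [sup_assoc, sup_eq_right.2 hleN]
  · ext q
    simp only [mem_trivialPrimes, Finset.mem_erase, hKle]
    constructor
    · rintro ⟨hq, h⟩
      exact ⟨fun hqp => hyj (hqp ▸ (h j).2), hq, fun i => (h i).1⟩
    · rintro ⟨hqp, hq, h⟩
      exact ⟨hq, fun i => ⟨h i, hyq q hq hqp i⟩⟩

theorem isCantorBendixsonRank (hg : IsCentralGenerator g π) :
    IsCantorBendixsonRank fun H : ClosedSubgroup G => (trivialPrimes g π H).card where
  eventually_lt H := (hg.eventually_trivialPrimes_ssubset H).mono fun K hK hne =>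
    Finset.card_lt_card (hK hne)
  frequently_eq H j hj := by
    obtain ⟨p, hp⟩ : (trivialPrimes g π H).Nonempty := Finset.card_pos.1 (by omega)
    refine (hg.frequently_trivialPrimes_eq_erase H hp).mono fun K hK => ?_
    rw [hK, Finset.card_erase_of_mem hp, hj, Nat.add_sub_cancel]

end IsCentralGenerator

theorem theorem4p2 {G : Type*} [Group G] [TopologicalSpace G] [IsTopologicalGroup G]
    [CompactSpace G] [TotallyDisconnectedSpace G]
    (hcountable : Countable (ClosedSubgroup G)) (hinfinite : Infinite (ClosedSubgroup G)) :
    (infinitePrimes G).Finite ∧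
      ∃ n : ℕ, 0 < n ∧
        Nonempty (ClosedSubgroup G ≃ₜ
          Set.Iio (Ordinal.omega0.{0} ^ (infinitePrimes G).ncard * (n : Ordinal.{0}) + 1)) := by
  obtain ⟨g, π, hg⟩ := exists_isCentralGenerator G
  refine ⟨hg.finite_infinitePrimes, ?_⟩
  rw [hg.ncard_infinitePrimes]
  have hr := hg.isCantorBendixsonRank
  have hle : ∀ H : ClosedSubgroup G, (trivialPrimes g π H).card ≤ π.card := fun H =>
    Finset.card_le_card fun p hp => (IsCentralGenerator.mem_trivialPrimes.1 hp).1
  refine hr.nonempty_homeomorph (fun h0 => ?_) hle ?_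
  · -- If `π` is empty, then all points of the compact space are isolated, so it is finite.
    have hfin := hr.finite_setOf_eq hle
    refine Set.infinite_univ (hfin.subset fun H _ => ?_)
    have := hle H
    exact show (trivialPrimes g π H).card = π.card by omega
  · refine ⟨⟨⊥, by
      change IsClosed ((⊥ : Subgroup G) : Set G)
      rw [Subgroup.coe_bot]
      exact isClosed_singleton⟩, congrArg Finset.card ?_⟩
    ext p
    rw [IsCentralGenerator.mem_trivialPrimes, bot_inf_eq]
    exact ⟨fun h => h.1, fun h => ⟨h, fun j => bot_le⟩⟩
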